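/- **Conventions.** Structures are multi-sorted, in arbitrary (set-sized) languages; the universe of $\mathbf M$ is the disjoint union of its sorts, and $\mathrm{Aut}(\mathbf M)$, the group of permutations of the universe that preserve all sorts and all basic relations and operations, carries the topology of pointwise convergence (the universe being discrete). *Definable* means invariant under automorphisms. A *sort of* $\mathbf M^{Eq}$ is a set $D/E$, where $D$ is a definable subset of a disjoint union $\bigsqcup_{i\in I} M^{n_i}$ of finite Cartesian powers of the universe ($I$ any set, $n_i\in\mathbb N$) and $E$ is a definable equivalence relation on $D$; $\mathrm{Aut}(\mathbf M)$ acts on it. An *interpretation* $g:\mathbf N\to\mathbf M$ is a bijection $g$ from the universe of $\mathbf N$ onto a sort of $\mathbf M^{Eq}$ such that the image of every sort, basic relation and (graph of a) basic operation of $\mathbf N$ is definable in $\mathbf M$. Two interpretations $g_1,g_2:\mathbf N\to\mathbf M$ are *equivalent* if the bijection $h:g_1(N)\to g_2(N)$ with $h\circ g_1=g_2$ is definable in $\mathbf M$. The category $\mathfrak M$ has the structures as objects and the equivalence classes of interpretations $\mathbf N\to\mathbf M$ as morphisms $\mathbf N\to\mathbf M$. An interpretation $g$ is an *embedding* if every finitary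 relation on $g(N)$ that is definable in $\mathbf M$ is already definable in $\mathbf N$ (transported to $g(N)$). A structure is *finitary* if it is a union of finite subsets that are first-order definable without parameters; $\mathfrak M_{\mathrm{fin}}$ is the full subcategory of $\mathfrak M$ of finitary structures. For a set $A$ of elements of a sort of $\mathbf M^{Eq}$, $\mathbf M/A$ is the expansion of $\mathbf M$ by names for the elements of $A$ (an element of $D/E$, being an $E$-class, is named by relation symbols for this class). **Theorem.** The map $\mathbf M\mapsto\mathrm{Aut}(\mathbf M)$ extends to a contravariant functor from $\mathfrak M$ to the category of topological groups and continuous homomorphisms, with the following properties. (i) The functor sends the class of an interpretation $g:\mathbf N\to\mathbf M$ to the restriction homomorphism $\hat g:\mathrm{Aut}(\mathbf M)\to\mathrm{Aut}(\mathbf N)$, that is $g(\hat g(\sigma)(x))=\sigma(g(x))$ for all $\sigma\in\mathrm{Aut}(\mathbf M)$ and $x\in N$. (ii) If $\mathbf M$ is finitary, then $\mathrm{Aut}(\mathbf M)$ is profinite (compact, Hausdorff and totally disconnected), and for every embedding $g:\mathbf N\hookrightarrow\mathbf M$ the homomorphism $\hat g:\mathrm{Aut}(\mathbf M)\to\mathrm{Aut}(\mathbf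 N)$ is surjective. (iii) For every set $A$ of elements of a sort of $\mathbf M^{Eq}$, the interpretation $g:\mathbf M\to\mathbf M/A$ given by the identity map corresponds to a topological embedding of groups $\hat g:\mathrm{Aut}(\mathbf M/A)\hookrightarrow\mathrm{Aut}(\mathbf M)$. (iv) The restriction of the functor to finitary structures, $\mathrm{Aut}:\mathfrak M_{\mathrm{fin}}^{\mathrm{op}}\to\mathfrak G_{\mathrm{pro}}$, is an equivalence of categories, where $\mathfrak G_{\mathrm{pro}}$ is the category of profinite groups and continuous homomorphisms. -/

import Mathlib

open CategoryTheory

universe u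

namespace ModelCat

/-! ### Multi-sorted languages and structures -/

/-- A multi-sorted language: sorts, relation symbols and function symbols (constants are function
symbols of arity `0`). -/
structure Signature where
  Srt : Type u
  Rel : Type u
  relArity : Rel → ℕ
  relSort : ∀ r, Fin (relArity r) → Srt
  Fn : Type u
  fnArity : Fn → ℕ
  fnSort : ∀ f, Fin (fnArity f) → Srt
  fnCod : Fn → Srt

/-- A multi-sorted structure, together with its language. -/
structure MStr where
  L : Signature.{u}
  carrier : L.Srt → Type u
  rel : ∀ r, Set (∀ k : Fin (L.relArity r), carrier (L.relSort r k))
  fn : ∀ f, (∀ k : Fin (L.fnArity f), carrier (L.fnSort f k)) → carrier (L.fnCod f)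

/-- The universe of a structure: the disjoint union of its sorts. -/
def MStr.Univ (M : MStr.{u}) : Type u := Σ s, M.carrier s

/-- The basic relations of `M`, as relations on the universe: its sorts, its named relations, and
the graphs of its named operations. -/
inductive MStr.IsBasic (M : MStr.{u}) : (n : ℕ) → Set (Fin n → M.Univ) → Prop
  | srt (s : M.L.Srt) : MStr.IsBasic M 1 {x | (x 0).1 = s}
  | rel (r : M.L.Rel) : MStr.IsBasic M (M.L.relArity r)
      {x | ∃ t ∈ M.rel r, x = fun k => ⟨M.L.relSort r k, t k⟩}
  | graph (f : M.L.Fn) : MStr.IsBasic M (M.L.fnArity f + 1)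
      {x | ∃ t : (∀ k, M.carrier (M.L.fnSort f k)),
        (∀ k, x k.castSucc = ⟨M.L.fnSort f k, t k⟩) ∧
        x (Fin.last _) = ⟨M.L.fnCod f, M.fn f t⟩}

/-! ### First-order formulas, finitary structures -/

/-- First-order terms of a given sort, with variables from a context `w` (a finite list of sorts). -/
inductive Signature.Term (L : Signature.{u}) {n : ℕ} (w : Fin n → L.Srt) : L.Srt → Type u
  | var (i : Fin n) : Term L w (w i)
  | app (f : L.Fn) (ts : ∀ k, Term L w (L.fnSort f k)) : Term L w (L.fnCod f)

/-- First-order formulas with free variables from a context. -/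
inductive Signature.Formula (L : Signature.{u}) : {n : ℕ} → (Fin n → L.Srt) → Type u
  | eq {n : ℕ} {w : Fin n → L.Srt} {s : L.Srt} (t₁ t₂ : L.Term w s) : Formula L w
  | rel {n : ℕ} {w : Fin n → L.Srt} (r : L.Rel) (ts : ∀ k, L.Term w (L.relSort r k)) : Formula L w
  | not {n : ℕ} {w : Fin n → L.Srt} (φ : Formula L w) : Formula L w
  | and {n : ℕ} {w : Fin n → L.Srt} (φ ψ : Formula L w) : Formula L w
  | all {n : ℕ} {w : Fin n → L.Srt} (s : L.Srt)
      (φ : Formula L (Fin.cons s w : Fin (n + 1) → L.Srt)) : Formula L w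

/-- The value of a term under an assignment of the variables. -/
def MStr.eval (M : MStr.{u}) {n : ℕ} {w : Fin n → M.L.Srt} (v : ∀ i, M.carrier (w i)) :
    {s : M.L.Srt} → M.L.Term w s → M.carrier s
  | _, .var i => v i
  | _, .app f ts => M.fn f fun k => M.eval v (ts k)

/-- Satisfaction of a formula under an assignment of the variables. -/
def MStr.Sat (M : MStr.{u}) : {n : ℕ} → {w : Fin n → M.L.Srt} → M.L.Formula w →
    (∀ i, M.carrier (w i)) → Prop
  | _, _, .eq t₁ t₂, v => M.eval v t₁ = M.eval v t₂
  | _, _, .rel r ts, v => (fun k => M.eval v (ts k)) ∈ M.rel r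
  | _, _, .not φ, v => ¬ M.Sat φ v
  | _, _, .and φ ψ, v => M.Sat φ v ∧ M.Sat ψ v
  | _, w, .all s φ, v => ∀ a : M.carrier s,
      M.Sat φ (Fin.cons (α := fun i => M.carrier ((Fin.cons s w : Fin _ → M.L.Srt) i)) a v)

/-- `X` is a subset of a sort of `M` that is first-order definable without parameters. -/
def MStr.FODefinable (M : MStr.{u}) (X : Set M.Univ) : Prop :=
  ∃ (s : M.L.Srt) (φ : M.L.Formula (fun _ : Fin 1 => s)),
    X = {x | ∃ a : M.carrier s, x = ⟨s, a⟩ ∧ M.Sat φ fun _ => a}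

/-- `M` is finitary: it is a union of finite first-order `0`-definable subsets. -/
def MStr.IsFinitary (M : MStr.{u}) : Prop :=
  ∃ 𝒳 : Set (Set M.Univ), (∀ X ∈ 𝒳, X.Finite ∧ M.FODefinable X) ∧ ⋃₀ 𝒳 = Set.univ

/-! ### The automorphism group -/

/-- The automorphism group of `M`, as a group of permutations of the universe. -/
def MStr.Aut (M : MStr.{u}) : Subgroup (Equiv.Perm M.Univ) where
  carrier := {σ | ∀ n R, M.IsBasic n R → ∀ x, x ∈ R ↔ (fun k => σ (x k)) ∈ R}
  one_mem' := fun _ _ _ _ => Iff.rfl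
  mul_mem' := fun {σ τ} hσ hτ n R hR x => (hτ n R hR x).trans (hσ n R hR fun k => τ (x k))
  inv_mem' := fun {σ} hσ n R hR x => by
    simpa using (hσ n R hR fun k => σ⁻¹ (x k)).symm

/-- The topology of pointwise convergence, the universe being discrete. -/
instance (M : MStr.{u}) : TopologicalSpace M.Aut :=
  TopologicalSpace.induced (fun σ => (σ.1 : M.Univ → M.Univ))
    (@Pi.topologicalSpace M.Univ (fun _ => M.Univ) fun _ => ⊥)

theorem MStr.continuous_to_aut {M : MStr.{u}} {X : Type*} [TopologicalSpace X] {F : X → M.Aut} :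
    Continuous F ↔ ∀ a b : M.Univ, IsOpen {x | (F x).1 a = b} := by
  let : TopologicalSpace M.Univ := ⊥
  have : DiscreteTopology M.Univ := ⟨rfl⟩
  rw [continuous_induced_rng, continuous_pi_iff]
  refine forall_congr' fun a => ?_
  rw [continuous_discrete_rng]
  rfl

theorem MStr.isOpen_aut {M : MStr.{u}} (a b : M.Univ) : IsOpen {σ : M.Aut | σ.1 a = b} :=
  MStr.continuous_to_aut.1 (continuous_id (X := M.Aut)) a b

instance (M : MStr.{u}) : IsTopologicalGroup M.Aut where
  continuous_mul := by
    rw [MStr.continuous_to_aut]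
    intro a b
    have : {p : M.Aut × M.Aut | (p.1 * p.2).1 a = b} =
        ⋃ c, {σ : M.Aut | σ.1 c = b} ×ˢ {τ : M.Aut | τ.1 a = c} := by
      ext p
      simp
    rw [this]
    exact isOpen_iUnion fun c => (MStr.isOpen_aut c b).prod (MStr.isOpen_aut a c)
  continuous_inv := by
    rw [MStr.continuous_to_aut]
    intro a b
    have : {σ : M.Aut | (σ⁻¹).1 a = b} = {σ : M.Aut | σ.1 b = a} := by
      ext σ
      exact Equiv.Perm.inv_eq_iff_eq.trans eq_comm
    rw [this]
    exact MStr.isOpen_aut b a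

/-! ### Definability, imaginary sorts -/

/-- A relation is definable (without parameters) if and only if it is invariant under
automorphisms. Here `X` is any set on which the automorphism group acts. -/
def MStr.Definable (M : MStr.{u}) {X : Type*} [MulAction M.Aut X] (R : Set X) : Prop :=
  ∀ σ : M.Aut, ∀ x ∈ R, σ • x ∈ R

/-- A finite Cartesian power of the universe; it is the disjoint union of the products of `n`
sorts. -/
abbrev MStr.Pow (M : MStr.{u}) (n : ℕ) : Type u := Fin n → M.Univ

/-- A sort `D / E` of `M^Eq`: `D` is a definable subset of a disjoint union of finite Cartesian
powers, and `E` is a definable equivalence relation on `D`. -/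
structure EqSort (M : MStr.{u}) where
  ι : Type u
  ar : ι → ℕ
  D : Set (Σ i, M.Pow (ar i))
  D_def : M.Definable D
  E : Setoid D
  E_def : M.Definable {p : (Σ i, M.Pow (ar i)) × (Σ i, M.Pow (ar i)) |
    ∃ (h₁ : p.1 ∈ D) (h₂ : p.2 ∈ D), E.r ⟨p.1, h₁⟩ ⟨p.2, h₂⟩}

/-- The elements of the sort, that is imaginary elements of `M`. -/
def EqSort.Univ {M : MStr.{u}} (S : EqSort M) : Type u := Quotient S.E

/-- The class in `D / E` of an element of `D`. -/
def EqSort.cls {M : MStr.{u}} (S : EqSort M) (d : S.D) : S.Univ := Quotient.mk S.E d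

/-- Automorphisms of `M` act on `D / E`. -/
instance {M : MStr.{u}} (S : EqSort M) : MulAction M.Aut S.Univ where
  smul σ := Quotient.map (fun d => ⟨σ • d.1, S.D_def σ d.1 d.2⟩) fun a b h => by
    obtain ⟨_, _, h'⟩ := S.E_def σ (a.1, b.1) ⟨a.2, b.2, h⟩
    exact h'
  one_smul x := by
    induction x using Quotient.inductionOn with
    | h d => exact congrArg (Quotient.mk S.E) (Subtype.ext (one_smul _ _))
  mul_smul σ τ x := by
    induction x using Quotient.inductionOn with
    | h d => exact congrArg (Quotient.mk S.E) (Subtype.ext (mul_smul _ _ _))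

theorem EqSort.smul_cls {M : MStr.{u}} (S : EqSort M) (σ : M.Aut) (d : S.D) :
    σ • S.cls d = S.cls ⟨σ • d.1, S.D_def σ d.1 d.2⟩ := rfl

/-! ### Interpretations -/

/-- A pre-morphism `N → M`: an interpretation of `N` in `M`, that is a bijection of `N` with a sort
of `M^Eq` under which the basic relations and operations of `N` become definable. -/
structure PreMor (N M : MStr.{u}) where
  S : EqSort M
  g : N.Univ ≃ S.Univ
  basic : ∀ n R, N.IsBasic n R → M.Definable ((fun x : N.Pow n => (fun k => g (x k))) '' R)

/-- Two interpretations are equivalent if the bijection `g₁(N) → g₂(N)`, `g₁ x ↦ g₂ x`, is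
definable. -/
def PreMor.Equivalent {N M : MStr.{u}} (g₁ g₂ : PreMor N M) : Prop :=
  ∃ h : g₁.S.Univ ≃ g₂.S.Univ, (∀ x, h (g₁.g x) = g₂.g x) ∧
    M.Definable {p : g₁.S.Univ × g₂.S.Univ | h p.1 = p.2}

/-- `g : N → M` is an embedding: every relation definable in `M` on the set `g(N)` is
definable in the structure `g(N)`, that is `g(N)` has no proper definable expansion. -/
def PreMor.IsEmbedding {N M : MStr.{u}} (g : PreMor N M) : Prop :=
  ∀ (n : ℕ) (R : Set (N.Pow n)),
    M.Definable ((fun x : N.Pow n => (fun k => g.g (x k))) '' R) → N.Definable R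

theorem PreMor.res_mem {N M : MStr.{u}} (g : PreMor N M) (σ : M.Aut) :
    (g.g.trans ((MulAction.toPerm σ).trans g.g.symm) : Equiv.Perm N.Univ) ∈ N.Aut := by
  have key : ∀ (σ : M.Aut) n R, N.IsBasic n R → ∀ x ∈ R,
      (fun k => g.g.symm (σ • g.g (x k))) ∈ R := by
    intro σ n R hR x hx
    obtain ⟨y, hy, hyx⟩ := g.basic n R hR σ _ ⟨x, hx, rfl⟩
    convert hy using 1
    funext k
    have := congrFun hyx k
    simp only [Pi.smul_apply] at this
    rw [← this, Equiv.symm_apply_apply]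
  intro n R hR x
  refine ⟨key σ n R hR x, fun h => ?_⟩
  simpa using key σ⁻¹ n R hR _ h

/-- The action of automorphisms of `M` on the interpreted structure. -/
def PreMor.res {N M : MStr.{u}} (g : PreMor N M) (σ : M.Aut) : N.Aut := ⟨_, g.res_mem σ⟩

theorem PreMor.g_res {N M : MStr.{u}} (g : PreMor N M) (σ : M.Aut) (x : N.Univ) :
    g.g (g.res σ • x) = σ • g.g x :=
  g.g.apply_symm_apply _

theorem PreMor.equivalent_iff {N M : MStr.{u}} (g₁ g₂ : PreMor N M) :
    g₁.Equivalent g₂ ↔ g₁.res = g₂.res := by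
  constructor
  · rintro ⟨h, hg, hd⟩
    funext σ
    refine Subtype.ext (Equiv.ext fun x => g₂.g.injective ?_)
    have h₁ := hd σ (g₁.g x, g₂.g x) (hg x)
    have h₂ : h (σ • g₁.g x) = σ • g₂.g x := h₁
    rw [← g₁.g_res, ← g₂.g_res, hg] at h₂
    exact h₂
  · intro h
    refine ⟨g₁.g.symm.trans g₂.g, fun x => by simp, ?_⟩
    rintro σ ⟨a, b⟩ hab
    obtain ⟨x, rfl⟩ := g₁.g.surjective a
    have hb : g₂.g x = b := by simpa using hab
    subst hb
    change g₂.g (g₁.g.symm (σ • g₁.g x)) = σ • g₂.g x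
    rw [← g₁.g_res, ← g₂.g_res, h, Equiv.symm_apply_apply]

instance PreMor.setoid (N M : MStr.{u}) : Setoid (PreMor N M) where
  r := PreMor.Equivalent
  iseqv :=
    { refl := fun g => (g.equivalent_iff g).2 rfl
      symm := fun {g₁ g₂} h => (g₂.equivalent_iff g₁).2 ((g₁.equivalent_iff g₂).1 h).symm
      trans := fun {g₁ g₂ g₃} h h' => (g₁.equivalent_iff g₃).2
        (((g₁.equivalent_iff g₂).1 h).trans ((g₂.equivalent_iff g₃).1 h')) }

section OfCoord

variable {N M : MStr.{u}} {ι : Type u} {ar : ι → ℕ} (D : Set (Σ i, M.Pow (ar i)))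
  (hD : M.Definable D) (p : D → N.Univ) (hp : Function.Surjective p) (α : M.Aut → N.Aut)
  (hα : ∀ σ (d : D), p ⟨σ • d.1, hD σ d.1 d.2⟩ = α σ • p d)

/-- The sort `D / ker p` for a map `p : D → N`. The compatibility of `p` with a map `α` of
automorphisms ensures that the equivalence relation is definable. -/
def EqSort.ofKer : EqSort M where
  ι := ι
  ar := ar
  D := D
  D_def := hD
  E := Setoid.ker p
  E_def := by
    rintro σ ⟨a, b⟩ ⟨ha, hb, hab⟩
    refine ⟨hD σ a ha, hD σ b hb, ?_⟩
    change p _ = p _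
    have hab' : p ⟨a, ha⟩ = p ⟨b, hb⟩ := hab
    have h₁ := hα σ ⟨a, ha⟩
    have h₂ := hα σ ⟨b, hb⟩
    rw [hab'] at h₁
    exact h₁.trans h₂.symm

/-- The bijection of `D / ker p` with `N`. -/
noncomputable def EqSort.kerEquiv : (EqSort.ofKer D hD p α hα).Univ ≃ N.Univ :=
  Setoid.quotientKerEquivOfSurjective p hp

theorem EqSort.kerEquiv_symm (d : D) :
    (EqSort.kerEquiv D hD p hp α hα).symm (p d) = (EqSort.ofKer D hD p α hα).cls d :=
  (Equiv.symm_apply_eq _).2 rfl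

theorem EqSort.kerEquiv_symm_smul (σ : M.Aut) (x : N.Univ) :
    (EqSort.kerEquiv D hD p hp α hα).symm (α σ • x) =
      σ • (EqSort.kerEquiv D hD p hp α hα).symm x := by
  obtain ⟨d, rfl⟩ := hp x
  rw [← hα σ d, EqSort.kerEquiv_symm, EqSort.kerEquiv_symm]
  rfl

/-- An interpretation given by a coordinate map `p` from a definable set `D` onto `N`: it is the
inverse of the induced bijection `D / ker p → N`. -/
noncomputable def PreMor.ofCoord : PreMor N M where
  S := EqSort.ofKer D hD p α hα
  g := (EqSort.kerEquiv D hD p hp α hα).symm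
  basic := by
    rintro n R hR σ _ ⟨x, hx, rfl⟩
    exact ⟨fun k => α σ • x k, ((α σ).2 n R hR x).1 hx,
      funext fun k => EqSort.kerEquiv_symm_smul D hD p hp α hα σ (x k)⟩

theorem PreMor.ofCoord_res : (PreMor.ofCoord D hD p hp α hα).res = α := by
  funext σ
  refine Subtype.ext (Equiv.ext fun x => (PreMor.ofCoord D hD p hp α hα).g.injective ?_)
  exact ((PreMor.ofCoord D hD p hp α hα).g_res σ x).trans
    (EqSort.kerEquiv_symm_smul D hD p hp α hα σ x).symm

end OfCoord

/-- The interpretation of `N` in `M` by a bijection of the universes. -/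
noncomputable def PreMor.ofBij {N M : MStr.{u}} (b : M.Univ ≃ N.Univ) (α : M.Aut → N.Aut)
    (hα : ∀ σ x, b (σ • x) = α σ • b x) : PreMor N M :=
  PreMor.ofCoord (ι := PUnit) (ar := fun _ => 1) Set.univ (fun _ _ _ => Set.mem_univ _)
    (fun d => b (d.1.2 0))
    (fun x => ⟨⟨⟨PUnit.unit, fun _ => b.symm x⟩, trivial⟩, b.apply_symm_apply x⟩) α
    (fun σ d => hα σ (d.1.2 0))

theorem PreMor.ofBij_res {N M : MStr.{u}} (b : M.Univ ≃ N.Univ) (α : M.Aut → N.Aut)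
    (hα : ∀ σ x, b (σ • x) = α σ • b x) : (PreMor.ofBij b α hα).res = α :=
  PreMor.ofCoord_res _ _ _ _ _ _

/-- The identity interpretation. -/
noncomputable def PreMor.id (M : MStr.{u}) : PreMor M M :=
  PreMor.ofBij (Equiv.refl _) (fun σ => σ) fun _ _ => rfl

theorem PreMor.id_res (M : MStr.{u}) : (PreMor.id M).res = fun σ => σ :=
  PreMor.ofBij_res _ _ _

section Comp

variable {N M K : MStr.{u}} (g : PreMor N M) (f : PreMor M K)

/-- The index set of the composite sort: an index of the sort `D / E` of `M`, and an index of the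
sort `D' / E'` of `K` for each of the coordinates. -/
abbrev PreMor.CompIdx : Type u := Σ i : g.S.ι, (Fin (g.S.ar i) → f.S.ι)

/-- The arity in the composite sort. -/
abbrev PreMor.compAr (c : PreMor.CompIdx g f) : ℕ := ∑ k, f.S.ar (c.2 k)

/-- A tuple of tuples of elements of `K`, written as one long tuple, is cut into its pieces. -/
def PreMor.piece (d : Σ c, K.Pow (PreMor.compAr g f c)) (k : Fin (g.S.ar d.1.1)) :
    Σ j, K.Pow (f.S.ar j) :=
  ⟨d.1.2 k, fun l => d.2 (finSigmaFinEquiv ⟨k, l⟩)⟩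

theorem PreMor.piece_smul (σ : K.Aut) (d : Σ c, K.Pow (PreMor.compAr g f c))
    (k : Fin (g.S.ar d.1.1)) :
    PreMor.piece g f (σ • d) k = σ • PreMor.piece g f d k := rfl

/-- The tuple of elements of `M` that is represented by a tuple of elements of `D'`. -/
noncomputable def PreMor.decode (d : Σ c, K.Pow (PreMor.compAr g f c))
    (h : ∀ k, PreMor.piece g f d k ∈ f.S.D) : Σ i, M.Pow (g.S.ar i) :=
  ⟨d.1.1, fun k => f.g.symm (f.S.cls ⟨PreMor.piece g f d k, h k⟩)⟩

theorem PreMor.decode_smul (σ : K.Aut) (d : Σ c, K.Pow (PreMor.compAr g f c))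
    (h : ∀ k, PreMor.piece g f d k ∈ f.S.D) (h' : ∀ k, PreMor.piece g f (σ • d) k ∈ f.S.D) :
    PreMor.decode g f (σ • d) h' = f.res σ • PreMor.decode g f d h := by
  refine Sigma.ext rfl (heq_of_eq (funext fun k => f.g.injective ?_))
  change f.g (f.g.symm _) = f.g (f.res σ • f.g.symm _)
  rw [f.g_res, Equiv.apply_symm_apply, Equiv.apply_symm_apply]
  rfl

/-- The definable set of all representatives of elements of `D`. -/
def PreMor.compD : Set (Σ c, K.Pow (PreMor.compAr g f c)) :=
  {d | ∃ h : ∀ k, PreMor.piece g f d k ∈ f.S.D, PreMor.decode g f d h ∈ g.S.D}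

theorem PreMor.compD_def : K.Definable (PreMor.compD g f) := by
  rintro σ d ⟨h, hd⟩
  have h' : ∀ k, PreMor.piece g f (σ • d) k ∈ f.S.D := fun k => f.S.D_def σ _ (h k)
  refine ⟨h', ?_⟩
  rw [PreMor.decode_smul g f σ d h h']
  exact g.S.D_def _ _ hd

/-- The composite of two interpretations `N → M → K`: an element of `N` is represented in `K` by a
tuple of representatives of the coordinates of a tuple in `M` that represents it. -/
noncomputable def PreMor.comp : PreMor N K :=
  PreMor.ofCoord (PreMor.compD g f) (PreMor.compD_def g f)
    (fun d => g.g.symm (g.S.cls ⟨PreMor.decode g f d.1 d.2.1, d.2.2⟩))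
    (by
      intro x
      obtain ⟨⟨⟨i, t⟩, ht⟩, hx⟩ := Quotient.exists_rep (g.g x)
      choose d hd using fun k => Quotient.exists_rep (f.g (t k))
      let c : PreMor.CompIdx g f := ⟨i, fun k => (d k).1.1⟩
      let d' : Σ c, K.Pow (PreMor.compAr g f c) :=
        ⟨c, fun l => (d (finSigmaFinEquiv.symm l).1).1.2 (finSigmaFinEquiv.symm l).2⟩
      have hp : ∀ k, PreMor.piece g f d' k = (d k).1 := by
        intro k
        refine Sigma.ext rfl (heq_of_eq (funext fun l => ?_))
        exact congrArg
          (fun q : Σ k : Fin (g.S.ar i), Fin (f.S.ar (d k).1.1) => (d q.1).1.2 q.2)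
          (Equiv.symm_apply_apply finSigmaFinEquiv ⟨k, l⟩)
      have h : ∀ k, PreMor.piece g f d' k ∈ f.S.D := fun k => (hp k).symm ▸ (d k).2
      have hdec : PreMor.decode g f d' h = ⟨i, t⟩ := by
        refine Sigma.ext rfl (heq_of_eq (funext fun k => ?_))
        change f.g.symm (f.S.cls ⟨PreMor.piece g f d' k, h k⟩) = t k
        rw [Equiv.symm_apply_eq, ← hd k]
        exact congrArg f.S.cls (Subtype.ext (hp k))
      refine ⟨⟨d', h, hdec ▸ ht⟩, ?_⟩
      rw [Equiv.symm_apply_eq, ← hx]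
      exact congrArg g.S.cls (Subtype.ext hdec))
    (fun σ => g.res (f.res σ))
    (by
      intro σ d
      apply g.g.injective
      rw [g.g_res, Equiv.apply_symm_apply, Equiv.apply_symm_apply, EqSort.smul_cls]
      exact congrArg g.S.cls (Subtype.ext (PreMor.decode_smul g f σ d.1 d.2.1 _)))

theorem PreMor.comp_res : (PreMor.comp g f).res = fun σ => g.res (f.res σ) :=
  PreMor.ofCoord_res _ _ _ _ _ _

end Comp

/-! ### The categories -/

/-- The category of all multi-sorted structures; a morphism `N ⟶ M` is an equivalence class of
interpretations of `N` in `M`. -/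
noncomputable instance : Category.{u + 1} MStr.{u} where
  Hom N M := Quotient (PreMor.setoid N M)
  id M := Quotient.mk _ (PreMor.id M)
  comp := Quotient.map₂ PreMor.comp fun g g' hg f f' hf => by
    refine (PreMor.equivalent_iff _ _).2 ?_
    rw [PreMor.comp_res, PreMor.comp_res, (PreMor.equivalent_iff g g').1 hg,
      (PreMor.equivalent_iff f f').1 hf]
  id_comp f := by
    induction f using Quotient.inductionOn with
    | h f =>
      refine Quotient.sound ((PreMor.equivalent_iff _ _).2 ?_)
      rw [PreMor.comp_res, PreMor.id_res]
  comp_id f := by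
    induction f using Quotient.inductionOn with
    | h f =>
      refine Quotient.sound ((PreMor.equivalent_iff _ _).2 ?_)
      rw [PreMor.comp_res, PreMor.id_res]
  assoc f g h := by
    induction f using Quotient.inductionOn with
    | h f =>
    induction g using Quotient.inductionOn with
    | h g =>
    induction h using Quotient.inductionOn with
    | h h =>
      refine Quotient.sound ((PreMor.equivalent_iff _ _).2 ?_)
      rw [PreMor.comp_res, PreMor.comp_res, PreMor.comp_res, PreMor.comp_res]

/-- The full subcategory of finitary structures. -/
abbrev FinStr : Type (u + 1) := ObjectProperty.FullSubcategory (C := MStr.{u}) MStr.IsFinitary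

/-- The inclusion of the category of finitary structures. -/
noncomputable abbrev finIncl : FinStr.{u} ⥤ MStr.{u} := ObjectProperty.ι (C := MStr.{u}) MStr.IsFinitary

/-- The morphism represented by an interpretation. -/
noncomputable def PreMor.toHom {N M : MStr.{u}} (g : PreMor N M) : N ⟶ M := Quotient.mk _ g

/-- The category of topological groups and continuous homomorphisms. -/
structure TopGrp where
  carrier : Type u
  [group : Group carrier]
  [top : TopologicalSpace carrier]
  [topGroup : IsTopologicalGroup carrier]

instance : CoeSort TopGrp.{u} (Type u) := ⟨TopGrp.carrier⟩

attribute [instance] TopGrp.group TopGrp.top TopGrp.topGroup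

instance : Category.{u} TopGrp.{u} where
  Hom G H := G →ₜ* H
  id G := ContinuousMonoidHom.id G
  comp f g := ContinuousMonoidHom.comp g f

/-- The underlying continuous homomorphism of a morphism. -/
def TopGrp.hom {G H : TopGrp.{u}} (f : G ⟶ H) : G →ₜ* H := f

/-- The inclusion of the category of profinite groups. -/
def profToTop : ProfiniteGrp.{u} ⥤ TopGrp.{u} where
  obj G := ⟨G⟩
  map f := f.hom

/-! ### Naming parameters -/

/-- The expansion `M / A` of `M` by names for a set `A` of imaginary elements. An element of
`D / E` is an `E`-class; it is named by relation symbols for the restrictions of this class to the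
products of sorts. -/
def MStr.name (M : MStr.{u}) (S : EqSort M) (A : Set S.Univ) : MStr.{u} where
  L :=
    { Srt := M.L.Srt
      Rel := M.L.Rel ⊕ (A × Σ i : S.ι, (Fin (S.ar i) → M.L.Srt))
      relArity := Sum.elim M.L.relArity fun q => S.ar q.2.1
      relSort := Sum.rec M.L.relSort fun q => q.2.2
      Fn := M.L.Fn
      fnArity := M.L.fnArity
      fnSort := M.L.fnSort
      fnCod := M.L.fnCod }
  carrier := M.carrier
  rel := Sum.rec M.rel fun q =>
    {t | ∃ h : (⟨q.2.1, fun k => ⟨q.2.2 k, t k⟩⟩ : Σ i, M.Pow (S.ar i)) ∈ S.D,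
      S.cls ⟨_, h⟩ = q.1.1}
  fn := M.fn

/-- An automorphism of the expansion is an automorphism of `M`. -/
def MStr.nameRes (M : MStr.{u}) (S : EqSort M) (A : Set S.Univ) (σ : (M.name S A).Aut) : M.Aut :=
  ⟨σ.1, fun n R hR => by
    cases hR with
    | srt s => exact σ.2 _ _ (.srt (M := M.name S A) s)
    | rel r => exact σ.2 _ _ (.rel (M := M.name S A) (Sum.inl r))
    | graph f => exact σ.2 _ _ (.graph (M := M.name S A) f)⟩

/-- The canonical interpretation of `M` in `M / A`, given by the identity map. -/
noncomputable def PreMor.name (M : MStr.{u}) (S : EqSort M) (A : Set S.Univ) : PreMor M (M.name S A) :=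
  PreMor.ofBij (N := M) (M := M.name S A) (Equiv.refl M.Univ) (M.nameRes S A) fun _ _ => rfl

end ModelCat

/-! Restriction along an interpretation determines its class: two interpretations are equivalent
exactly when they restrict automorphisms in the same way (`PreMor.equivalent_iff`). Since an
imaginary element is represented by a finite tuple, its stabiliser is open, so restriction is
continuous.

Conversely, let `φ : Aut M → Aut N` be a continuous homomorphism. Every `x` in `N` is fixed by `φ σ`
whenever `σ` fixes a suitable finite tuple `d x`. Sending the conjugate `σ • d x` to `φ σ • x` is
then well defined and presents `N` as a sort of `M^Eq` (`MStr.homRes_surjective`). Hence the functor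
is fully faithful on all structures; finitarity serves only to make the groups profinite.

If `M` is finitary, `Aut M` is closed in a product of finite sets, hence compact. Surjectivity of a
continuous homomorphism from a compact group then reduces to density: its image must move each
finite tuple as any given automorphism does (`MStr.surjective_of_tuples`). For an embedding this
holds because orbits of tuples under the image are definable in `M`, hence in `N`. For a profinite
group acting on the cosets of its open subgroups it holds because these orbits are the basic
relations; the action is faithful because open normal subgroups separate points from the identity.
This gives essential surjectivity. -/

namespace ModelCat

/-! ### Automorphisms preserve first-order formulas -/

theorem MStr.aut_fst {M : MStr.{u}} (σ : M.Aut) (x : M.Univ) : (σ.1 x).1 = x.1 :=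
  (σ.2 1 _ (.srt x.1) fun _ => x).1 rfl

theorem MStr.exists_aut_eq {M : MStr.{u}} (σ : M.Aut) (s : M.L.Srt) (a : M.carrier s) :
    ∃ b, σ.1 ⟨s, a⟩ = ⟨s, b⟩ := by
  have h := MStr.aut_fst σ ⟨s, a⟩
  generalize σ.1 ⟨s, a⟩ = y at h ⊢
  obtain ⟨s', b⟩ := y
  obtain rfl : s' = s := h
  exact ⟨b, rfl⟩

theorem MStr.aut_eval {M : MStr.{u}} (σ : M.Aut) {n : ℕ} {w : Fin n → M.L.Srt}
    {v v' : ∀ i, M.carrier (w i)}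
    (hv : ∀ i, σ.1 (⟨w i, v i⟩ : M.Univ) = (⟨w i, v' i⟩ : M.Univ))
    {s : M.L.Srt} (t : M.L.Term w s) :
    σ.1 (⟨s, M.eval v t⟩ : M.Univ) = (⟨s, M.eval v' t⟩ : M.Univ) := by
  induction t with
  | var i => exact hv i
  | app f ts ih =>
    let x : Fin (M.L.fnArity f + 1) → M.Univ :=
      Fin.snoc (α := fun _ => M.Univ) (fun k => ⟨M.L.fnSort f k, M.eval v (ts k)⟩)
        ⟨M.L.fnCod f, M.fn f fun k => M.eval v (ts k)⟩
    obtain ⟨t', h₁, h₂⟩ := (σ.2 _ _ (.graph f) x).1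
      ⟨fun k => M.eval v (ts k), fun k => Fin.snoc_castSucc .., Fin.snoc_last ..⟩
    have h₃ : t' = fun k => M.eval v' (ts k) := by
      funext k
      have hx : x k.castSucc = ⟨M.L.fnSort f k, M.eval v (ts k)⟩ := Fin.snoc_castSucc ..
      have h : (⟨M.L.fnSort f k, M.eval v' (ts k)⟩ : M.Univ) = ⟨M.L.fnSort f k, t' k⟩ :=
        (ih k).symm.trans ((congrArg σ.1 hx).symm.trans (h₁ k))
      exact (eq_of_heq (Sigma.mk.inj h).2).symm
    subst h₃
    have hx : x (Fin.last _) = ⟨M.L.fnCod f, M.fn f fun k => M.eval v (ts k)⟩ := Fin.snoc_last ..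
    exact (congrArg σ.1 hx).symm.trans h₂

/-- Induction on the formula; at a quantifier, `σ` and `σ⁻¹` match the values within each sort. The
second assignment `v'` is linked to `v` only through the universe, since `σ` acts there and not on
the individual carriers. -/
theorem MStr.aut_sat {M : MStr.{u}} (σ : M.Aut) {n : ℕ} {w : Fin n → M.L.Srt}
    (φ : M.L.Formula w) {v v' : ∀ i, M.carrier (w i)}
    (hv : ∀ i, σ.1 (⟨w i, v i⟩ : M.Univ) = (⟨w i, v' i⟩ : M.Univ)) :
    M.Sat φ v ↔ M.Sat φ v' := by
  induction φ with
  | @eq n w s t₁ t₂ =>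
    have h₁ := MStr.aut_eval σ hv t₁
    have h₂ := MStr.aut_eval σ hv t₂
    change M.eval v t₁ = M.eval v t₂ ↔ M.eval v' t₁ = M.eval v' t₂
    constructor
    · intro h
      rw [h, h₂] at h₁
      exact (eq_of_heq (Sigma.mk.inj h₁).2).symm
    · intro h
      rw [h, ← h₂] at h₁
      exact eq_of_heq (Sigma.mk.inj (σ.1.injective h₁)).2
  | rel r ts =>
    change (fun k => M.eval v (ts k)) ∈ M.rel r ↔ (fun k => M.eval v' (ts k)) ∈ M.rel r
    have key := σ.2 _ _ (.rel r) fun k => ⟨M.L.relSort r k, M.eval v (ts k)⟩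
    have aux : ∀ t t' : ∀ k, M.carrier (M.L.relSort r k),
        ((fun k => ⟨M.L.relSort r k, t k⟩ : Fin (M.L.relArity r) → M.Univ) =
          fun k => ⟨M.L.relSort r k, t' k⟩) → t = t' := fun t t' h =>
      funext fun k => eq_of_heq (Sigma.mk.inj (congrFun h k)).2
    simp only [MStr.aut_eval σ hv] at key
    constructor
    · intro h
      obtain ⟨t, ht, h'⟩ := key.1 ⟨_, h, rfl⟩
      rwa [aux _ _ h']
    · intro h
      obtain ⟨t, ht, h'⟩ := key.2 ⟨_, h, rfl⟩
      rwa [aux _ _ h']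
  | not φ ih => exact not_congr (ih hv)
  | and φ ψ ih₁ ih₂ => exact and_congr (ih₁ hv) (ih₂ hv)
  | @all n w s φ ih =>
    have hcons : ∀ a b : M.carrier s, σ.1 (⟨s, a⟩ : M.Univ) = (⟨s, b⟩ : M.Univ) →
        (M.Sat φ (Fin.cons (α := fun i => M.carrier ((Fin.cons s w : Fin _ → M.L.Srt) i)) a v) ↔
          M.Sat φ
            (Fin.cons (α := fun i => M.carrier ((Fin.cons s w : Fin _ → M.L.Srt) i)) b v')) :=
      fun a b hab => ih fun i => by
        refine Fin.cases ?_ (fun i => ?_) i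
        · exact hab
        · exact hv i
    constructor
    · intro h b
      obtain ⟨a, ha⟩ := MStr.exists_aut_eq σ⁻¹ s b
      exact (hcons a b (by rw [← ha]; exact σ.1.apply_symm_apply _)).1 (h a)
    · intro h a
      obtain ⟨b, hb⟩ := MStr.exists_aut_eq σ s a
      exact (hcons a b hb).2 (h b)

theorem MStr.FODefinable.aut_mem {M : MStr.{u}} {X : Set M.Univ} (hX : M.FODefinable X)
    (σ : M.Aut) {x : M.Univ} (hx : x ∈ X) : σ.1 x ∈ X := by
  obtain ⟨s, φ, rfl⟩ := hX
  obtain ⟨a, rfl, ha⟩ := hx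
  obtain ⟨b, hb⟩ := MStr.exists_aut_eq σ s a
  exact ⟨b, hb, (MStr.aut_sat σ φ fun _ => hb).1 ha⟩

/-! ### The topology of the automorphism group -/

/-- The discrete topology is written out because the universe carries no topology instance. -/
theorem MStr.isInducing_aut (M : MStr.{u}) :
    @Topology.IsInducing _ _ _ (@Pi.topologicalSpace M.Univ (fun _ => M.Univ) fun _ => ⊥)
      (fun σ : M.Aut => (σ.1 : M.Univ → M.Univ)) :=
  @Topology.IsInducing.mk _ _ _ (@Pi.topologicalSpace M.Univ (fun _ => M.Univ) fun _ => ⊥) _ rfl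

theorem MStr.aut_fun_injective (M : MStr.{u}) :
    Function.Injective (fun σ : M.Aut => (σ.1 : M.Univ → M.Univ)) :=
  fun _ _ h => Subtype.ext (DFunLike.coe_injective h)

theorem MStr.isEmbedding_aut (M : MStr.{u}) :
    @Topology.IsEmbedding _ _ _ (@Pi.topologicalSpace M.Univ (fun _ => M.Univ) fun _ => ⊥)
      (fun σ : M.Aut => (σ.1 : M.Univ → M.Univ)) :=
  let : TopologicalSpace M.Univ := ⊥
  ⟨M.isInducing_aut, M.aut_fun_injective⟩

instance (M : MStr.{u}) : T2Space M.Aut :=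
  let : TopologicalSpace M.Univ := ⊥
  have : DiscreteTopology M.Univ := ⟨rfl⟩
  M.isEmbedding_aut.t2Space

instance (M : MStr.{u}) : TotallyDisconnectedSpace M.Aut :=
  let : TopologicalSpace M.Univ := ⊥
  have : DiscreteTopology M.Univ := ⟨rfl⟩
  M.isEmbedding_aut.isTotallyDisconnected_range.1
    (isTotallyDisconnected_of_totallyDisconnectedSpace _)

/-- A neighbourhood of an automorphism contains all automorphisms that agree with it on some finite
tuple. -/
theorem MStr.exists_tuple_of_mem_nhds {M : MStr.{u}} {τ : M.Aut} {U : Set M.Aut}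
    (hU : U ∈ nhds τ) :
    ∃ (n : ℕ) (x : M.Pow n), ∀ σ : M.Aut, σ • x = τ • x → σ ∈ U := by
  let : TopologicalSpace M.Univ := ⊥
  have : DiscreteTopology M.Univ := ⟨rfl⟩
  rw [M.isInducing_aut.nhds_eq_comap, Filter.mem_comap, nhds_pi] at hU
  obtain ⟨V, hV, hVU⟩ := hU
  obtain ⟨I, hI, t, ht, hIt⟩ := Filter.mem_pi.1 hV
  obtain ⟨n, x, -, rfl⟩ := hI.fin_param
  refine ⟨n, x, fun σ hσ => hVU (hIt ?_)⟩
  rintro _ ⟨k, rfl⟩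
  have h : σ.1 (x k) = τ.1 (x k) := congrFun hσ k
  change σ.1 (x k) ∈ t (x k)
  rw [h]
  exact mem_of_mem_nhds (ht (x k))

theorem MStr.isOpen_smul_tuple {M : MStr.{u}} {n : ℕ} (x y : M.Pow n) :
    IsOpen {σ : M.Aut | σ • x = y} := by
  have : {σ : M.Aut | σ • x = y} = ⋂ k, {σ : M.Aut | σ.1 (x k) = y k} := by
    ext σ
    simp only [Set.mem_iInter, Set.mem_ofPred_eq]
    exact funext_iff
  rw [this]
  exact isOpen_iInter_of_finite fun k => MStr.isOpen_aut _ _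

/-- An automorphism that agrees with `τ` on one finite representative of `a` also agrees with `τ` on
the class `a`. -/
theorem EqSort.isOpen_smul {M : MStr.{u}} (S : EqSort M) (a b : S.Univ) :
    IsOpen {σ : M.Aut | σ • a = b} := by
  obtain ⟨⟨⟨i, x⟩, hx⟩, rfl⟩ := Quotient.exists_rep a
  refine isOpen_iff_mem_nhds.2 fun τ hτ => ?_
  refine Filter.mem_of_superset ((MStr.isOpen_smul_tuple x (τ • x)).mem_nhds rfl) fun σ hσ => ?_
  refine Eq.trans ?_ hτ
  refine congrArg S.cls (Subtype.ext ?_)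
  exact Sigma.ext rfl (heq_of_eq hσ)

/-- A continuous homomorphism from a compact group to `Aut M` whose image moves finite tuples like
every automorphism does is surjective. -/
theorem MStr.surjective_of_tuples {M : MStr.{u}} {G : Type*} [TopologicalSpace G] [CompactSpace G]
    {φ : G → M.Aut} (hφ : Continuous φ)
    (h : ∀ (τ : M.Aut) (n : ℕ) (x : M.Pow n), ∃ g, φ g • x = τ • x) : Function.Surjective φ := by
  rw [← Set.range_eq_univ, ← (isCompact_range hφ).isClosed.closure_eq, Set.eq_univ_iff_forall]
  refine fun τ => mem_closure_iff_nhds.2 fun U hU => ?_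
  obtain ⟨n, x, hx⟩ := MStr.exists_tuple_of_mem_nhds hU
  obtain ⟨g, hg⟩ := h τ n x
  exact ⟨φ g, hx _ hg, g, rfl⟩

/-- Automorphisms preserve the finite definable sets covering `M`, so they lie in a product of
finite sets, compact by Tychonoff. It remains to see that they form a closed set of functions. -/
theorem MStr.IsFinitary.compactSpace {M : MStr.{u}} (hM : M.IsFinitary) : CompactSpace M.Aut := by
  let : TopologicalSpace M.Univ := ⊥
  have : DiscreteTopology M.Univ := ⟨rfl⟩
  obtain ⟨𝒳, h𝒳, hcover⟩ := hM
  have hX : ∀ x : M.Univ, ∃ X ∈ 𝒳, x ∈ X := fun x => Set.eq_univ_iff_forall.1 hcover x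
  choose X hX hxX using hX
  have hmem : ∀ (f : M.Univ → M.Univ) (x : M.Univ) (A : Set M.Univ),
      IsClopen {f : M.Univ → M.Univ | f x ∈ A} := fun f x A =>
    (isClopen_discrete A).preimage (continuous_apply x)
  -- Each condition on the right is closed, being an intersection of conditions on finitely many
  -- values of `f`. Surjectivity, not closed in general, need not be listed.
  have hrange : Set.range (fun σ : M.Aut => (σ.1 : M.Univ → M.Univ)) =
      (⋂ (Y ∈ 𝒳) (x ∈ Y), {f | f x ∈ Y}) ∩ {f | Function.Injective f} ∩
        ⋂ (n : ℕ) (R : Set (M.Pow n)) (_ : M.IsBasic n R) (x : M.Pow n),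
          {f | x ∈ R ↔ (fun k => f (x k)) ∈ R} := by
    ext f
    simp only [Set.mem_range, Set.mem_inter_iff, Set.mem_iInter, Set.mem_ofPred_eq]
    constructor
    · rintro ⟨σ, rfl⟩
      exact ⟨⟨fun Y hY x hx => (h𝒳 Y hY).2.aut_mem σ hx, σ.1.injective⟩, σ.2⟩
    · rintro ⟨⟨hf, hinj⟩, hR⟩
      -- An injective self-map of the finite set `X y` is onto, so it attains `y`.
      have hsurj : Function.Surjective f := fun y => by
        have := (h𝒳 _ (hX y)).1.to_subtype
        have hmaps : Set.MapsTo f (X y) (X y) := hf _ (hX y)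
        obtain ⟨x, hx⟩ := Finite.surjective_of_injective
          (hmaps.restrict_inj.2 hinj.injOn) ⟨y, hxX y⟩
        exact ⟨x.1, congrArg Subtype.val hx⟩
      exact ⟨⟨Equiv.ofBijective f ⟨hinj, hsurj⟩, hR⟩, rfl⟩
  have hclosed : IsClosed (Set.range (fun σ : M.Aut => (σ.1 : M.Univ → M.Univ))) := by
    rw [hrange]
    refine ((isClosed_biInter fun Y _ => isClosed_biInter fun x _ => (hmem id x Y).1).inter ?_).inter
      (isClosed_iInter fun n => isClosed_iInter fun R => isClosed_iInter fun _ =>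
        isClosed_iInter fun x => ?_)
    · have : {f : M.Univ → M.Univ | Function.Injective f} =
          ⋂ (a) (b) (_ : a ≠ b), {f | f a ≠ f b} := by
        ext f
        simp only [Set.mem_iInter, Set.mem_ofPred_eq]
        exact ⟨fun h a b hab => h.ne hab, fun h a b hab => by_contra fun hne => h a b hne hab⟩
      rw [this]
      exact isClosed_iInter fun a => isClosed_iInter fun b => isClosed_iInter fun _ =>
        ((isClopen_discrete {p : M.Univ × M.Univ | p.1 ≠ p.2}).preimage
          (f := fun f : M.Univ → M.Univ => (f a, f b)) ((continuous_apply a).prodMk (continuous_apply b))).1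
    · exact ((isClopen_discrete {y : M.Pow n | x ∈ _ ↔ y ∈ _}).preimage
        (continuous_pi fun k => continuous_apply (x k))).1
  have hcompact : IsCompact (Set.range (fun σ : M.Aut => (σ.1 : M.Univ → M.Univ))) := by
    refine (isCompact_univ_pi fun x => (h𝒳 _ (hX x)).1.isCompact).of_isClosed_subset hclosed ?_
    rintro _ ⟨σ, rfl⟩ x -
    exact (h𝒳 _ (hX x)).2.aut_mem σ (hxX x)
  exact ⟨M.isInducing_aut.isCompact_iff.2 (by rwa [Set.image_univ])⟩

/-! ### Restriction of automorphisms -/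

/-- The restriction homomorphism of an interpretation. -/
def PreMor.resHom {N M : MStr.{u}} (g : PreMor N M) : M.Aut →ₜ* N.Aut where
  toFun := g.res
  map_one' := Subtype.ext <| Equiv.ext fun x => g.g.injective <|
    (g.g_res 1 x).trans (one_smul _ _)
  map_mul' σ τ := Subtype.ext <| Equiv.ext fun x => g.g.injective <| by
    refine (g.g_res (σ * τ) x).trans ?_
    change _ = g.g (g.res σ • (g.res τ • x))
    rw [g.g_res, g.g_res, mul_smul]
  continuous_toFun := by
    rw [MStr.continuous_to_aut]
    intro a b
    have : {σ : M.Aut | (g.res σ).1 a = b} = {σ : M.Aut | σ • g.g a = g.g b} := by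
      ext σ
      change g.res σ • a = b ↔ σ • g.g a = g.g b
      rw [← g.g_res, g.g.injective.eq_iff]
    rw [this]
    exact g.S.isOpen_smul _ _

/-- The restriction homomorphism of a morphism of structures. -/
def MStr.homRes {N M : MStr.{u}} (f : N ⟶ M) : M.Aut →ₜ* N.Aut :=
  Quotient.lift PreMor.resHom (fun g₁ g₂ h => ContinuousMonoidHom.ext fun σ =>
    congrFun ((g₁.equivalent_iff g₂).1 h) σ) f

theorem MStr.homRes_id (M : MStr.{u}) : MStr.homRes (𝟙 M) = ContinuousMonoidHom.id M.Aut :=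
  ContinuousMonoidHom.ext fun σ => congrFun (PreMor.id_res M) σ

theorem MStr.homRes_comp {N M K : MStr.{u}} (g : N ⟶ M) (f : M ⟶ K) :
    MStr.homRes (g ≫ f) = (MStr.homRes g).comp (MStr.homRes f) := by
  induction g using Quotient.inductionOn with
  | h g =>
  induction f using Quotient.inductionOn with
  | h f => exact ContinuousMonoidHom.ext fun σ => congrFun (PreMor.comp_res g f) σ

/-- This is the harder half of `PreMor.equivalent_iff`: equal restrictions make the comparison
bijection equivariant, hence definable. -/
theorem MStr.homRes_injective {N M : MStr.{u}} :
    Function.Injective (MStr.homRes : (N ⟶ M) → (M.Aut →ₜ* N.Aut)) := by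
  intro g f h
  induction g using Quotient.inductionOn with
  | h g =>
  induction f using Quotient.inductionOn with
  | h f =>
  exact Quotient.sound ((g.equivalent_iff f).2 (funext fun σ => DFunLike.congr_fun h σ))

/-- Every continuous homomorphism of automorphism groups is induced by an interpretation: `x` is
represented by the conjugates of a finite tuple whose stabiliser fixes `x`. -/
theorem MStr.homRes_surjective {N M : MStr.{u}} :
    Function.Surjective (MStr.homRes : (N ⟶ M) → (M.Aut →ₜ* N.Aut)) := by
  intro φ
  have hstab : ∀ x : N.Univ, ∃ (n : ℕ) (d : M.Pow n), ∀ σ : M.Aut, σ • d = d → φ σ • x = x := by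
    intro x
    have hU : {σ : M.Aut | φ σ • x = x} ∈ nhds 1 :=
      (MStr.continuous_to_aut.1 φ.continuous_toFun x x).mem_nhds
        (show φ 1 • x = x by rw [map_one, one_smul])
    obtain ⟨n, d, hd⟩ := MStr.exists_tuple_of_mem_nhds hU
    exact ⟨n, d, fun σ hσ => hd σ (hσ.trans (one_smul _ _).symm)⟩
  choose n d hd using hstab
  -- The index `x` is kept as part of the data, so that tuples chosen for different elements cannot
  -- collide.
  let D : Set (Σ x : N.Univ, M.Pow (n x)) := {p | ∃ σ : M.Aut, σ • d p.1 = p.2}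
  have hD : M.Definable D := by
    rintro σ ⟨x, t⟩ ⟨τ, hτ⟩
    exact ⟨σ * τ, (mul_smul σ τ (d x)).trans (congrArg (σ • ·) hτ)⟩
  let p : D → N.Univ := fun q => φ q.2.choose • q.1.1
  -- Independence of the choice in `p`: two automorphisms carrying `d x` to the same tuple differ by
  -- one fixing `d x`, whose image under `φ` fixes `x`.
  have hp : ∀ (q : D) (τ : M.Aut), τ • d q.1.1 = q.1.2 → p q = φ τ • q.1.1 := by
    intro q τ hτ
    have h : (τ⁻¹ * q.2.choose) • d q.1.1 = d q.1.1 := by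
      rw [mul_smul, q.2.choose_spec, ← hτ, inv_smul_smul]
    have := hd q.1.1 _ h
    rw [map_mul, map_inv, mul_smul, inv_smul_eq_iff] at this
    exact this
  refine ⟨(PreMor.ofCoord D hD p (fun x => ⟨⟨⟨x, d x⟩, 1, one_smul _ _⟩, ?_⟩) φ ?_).toHom, ?_⟩
  · rw [hp _ 1 (one_smul _ _), map_one, one_smul]
  · rintro σ q
    obtain ⟨τ, hτ⟩ := q.2
    rw [hp q τ hτ, ← mul_smul, ← map_mul]
    exact hp _ _ ((mul_smul σ τ _).trans (congrArg (σ • ·) hτ))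
  · exact ContinuousMonoidHom.ext fun σ => congrFun (PreMor.ofCoord_res D hD p _ φ _) σ

/-- The orbit of a tuple under the restricted automorphisms is definable in `M`, so the embedding
property makes it invariant under all of `Aut N`. Thus the image is dense, and it is compact. -/
theorem PreMor.IsEmbedding.res_surjective {N M : MStr.{u}} {g : PreMor N M} (hg : g.IsEmbedding)
    (hM : M.IsFinitary) : Function.Surjective g.res := by
  have := hM.compactSpace
  refine MStr.surjective_of_tuples g.resHom.continuous_toFun fun τ n x => ?_
  refine hg n (Set.range fun σ : M.Aut => g.res σ • x) ?_ τ x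
    ⟨1, (congrArg (· • x) (map_one g.resHom)).trans (one_smul _ _)⟩
  rintro σ _ ⟨_, ⟨σ', rfl⟩, rfl⟩
  refine ⟨_, ⟨σ * σ', rfl⟩, funext fun k => ?_⟩
  change g.g (g.res (σ * σ') • x k) = σ • g.g (g.res σ' • x k)
  rw [g.g_res, g.g_res, mul_smul]

/-- Both groups act on the same universe, and the embedding of `Aut (M / A)` into the space of
functions factors through `nameRes`. -/
theorem PreMor.isEmbedding_resHom_name (M : MStr.{u}) (S : EqSort M) (A : Set S.Univ) :
    Topology.IsEmbedding (PreMor.name M S A).resHom := by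
  let : TopologicalSpace M.Univ := ⊥
  have : DiscreteTopology M.Univ := ⟨rfl⟩
  have hres : (PreMor.name M S A).res = M.nameRes S A := PreMor.ofBij_res _ _ _
  have h : Topology.IsEmbedding (M.nameRes S A) := by
    refine Topology.IsEmbedding.of_comp ?_ M.isInducing_aut.continuous
      (M.name S A).isEmbedding_aut
    rw [← hres]
    exact (PreMor.name M S A).resHom.continuous_toFun
  rw [← hres] at h
  exact h

/-! ### Profinite groups as automorphism groups -/

section OrbitStr

variable (G : Type u) [Group G] [TopologicalSpace G]

/-- The structure whose sorts are the quotients `G ⧸ U` by open subgroups and whose relations are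
the orbits of finite tuples. -/
def orbitStr : MStr.{u} where
  L :=
    { Srt := OpenSubgroup G
      Rel := Σ n : ℕ, Fin n → Σ U : OpenSubgroup G, G ⧸ U.toSubgroup
      relArity := fun r => r.1
      relSort := fun r k => (r.2 k).1
      Fn := PEmpty
      fnArity := PEmpty.elim
      fnSort := fun f => f.elim
      fnCod := PEmpty.elim }
  carrier := fun U => G ⧸ U.toSubgroup
  rel := fun r => {t | ∃ g : G, ∀ k, t k = g • (r.2 k).2}
  fn := fun f => f.elim

variable {G} in
/-- An element of a sort of `orbitStr G`, as an element of the universe. -/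
def orbitStr.mk (U : OpenSubgroup G) (a : G ⧸ U.toSubgroup) : (orbitStr G).Univ := ⟨U, a⟩

variable {G} in
theorem orbitStr.mk_injective (U : OpenSubgroup G) : Function.Injective (orbitStr.mk U) :=
  fun _ _ h => eq_of_heq (Sigma.mk.inj h).2

/-- The group `G` acts on `orbitStr G` by left multiplication. -/
instance : MulAction G (orbitStr G).Univ where
  smul g x := orbitStr.mk x.1 (g • (show G ⧸ OpenSubgroup.toSubgroup x.1 from x.2))
  one_smul x := congrArg (orbitStr.mk x.1)
    (one_smul G (show G ⧸ OpenSubgroup.toSubgroup x.1 from x.2))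
  mul_smul g h x := congrArg (orbitStr.mk x.1)
    (mul_smul g h (show G ⧸ OpenSubgroup.toSubgroup x.1 from x.2))

theorem toPerm_mem_aut (g : G) :
    (MulAction.toPerm g : Equiv.Perm (orbitStr G).Univ) ∈ (orbitStr G).Aut := by
  have key : ∀ (g : G) n R, (orbitStr G).IsBasic n R → ∀ x ∈ R, (fun k => g • x k) ∈ R := by
    intro g n R hR x hx
    cases hR with
    | srt s => exact hx
    | rel r =>
      obtain ⟨t, ⟨h, ht⟩, rfl⟩ := hx
      exact ⟨fun k => g • (show G ⧸ OpenSubgroup.toSubgroup (r.2 k).1 from t k),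
        ⟨g * h, fun k => (congrArg (g • ·) (ht k)).trans (mul_smul g h (r.2 k).2).symm⟩, rfl⟩
    | graph f => exact PEmpty.elim f
  intro n R hR x
  refine ⟨key g n R hR x, fun h => ?_⟩
  simpa only [MulAction.toPerm_apply, inv_smul_smul] using key g⁻¹ n R hR _ h

/-- The action of `G` on `orbitStr G` by automorphisms. -/
def orbitHom : G →* (orbitStr G).Aut :=
  (MulAction.toPermHom G (orbitStr G).Univ).codRestrict _ (toPerm_mem_aut G)

theorem orbitHom_mk (g : G) (U : OpenSubgroup G) (a : G ⧸ U.toSubgroup) :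
    (orbitHom G g).1 (orbitStr.mk U a) = orbitStr.mk U (g • a) := rfl

/-- The relation indexed by `x` is the `G`-orbit of `x`. It contains `x`, and `τ` preserves it. -/
theorem orbitHom_tuple (τ : (orbitStr G).Aut) (n : ℕ) (x : (orbitStr G).Pow n) :
    ∃ g, orbitHom G g • x = τ • x := by
  obtain ⟨t, ⟨g, hg⟩, h⟩ := (τ.2 _ _ (.rel (M := orbitStr G) ⟨n, x⟩) x).1
    ⟨fun k => (x k).2, ⟨1, fun k => (one_smul G (show G ⧸ OpenSubgroup.toSubgroup (x k).1 from (x k).2)).symm⟩, rfl⟩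
  exact ⟨g, funext fun k =>
    ((congrFun h k).trans (congrArg (orbitStr.mk (x k).1) (hg k))).symm⟩

theorem orbitStr_isFinitary [IsTopologicalGroup G] [CompactSpace G] :
    (orbitStr G).IsFinitary := by
  refine ⟨Set.range fun U : OpenSubgroup G => {x : (orbitStr G).Univ | x.1 = U}, ?_, ?_⟩
  · rintro _ ⟨U, rfl⟩
    have h : {x : (orbitStr G).Univ | x.1 = U} =
        Set.range (orbitStr.mk U) := by
      ext ⟨V, a⟩
      constructor
      · rintro rfl
        exact ⟨a, rfl⟩
      · rintro ⟨b, hb⟩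
        exact (congrArg Sigma.fst hb).symm
    have hfin : {x : (orbitStr G).Univ | x.1 = U}.Finite := h ▸ Set.finite_range _
    -- A whole sort is defined by the formula `x = x`; it is finite because an open subgroup of a
    -- compact group has finite index.
    refine ⟨hfin, U, .eq (.var 0) (.var 0), h.trans ?_⟩
    ext x
    exact ⟨fun ⟨a, ha⟩ => ⟨a, ha.symm, rfl⟩, fun ⟨a, ha, _⟩ => ⟨a, ha.symm⟩⟩
  · exact Set.eq_univ_of_forall fun x => ⟨_, ⟨x.1, rfl⟩, rfl⟩

variable [IsTopologicalGroup G]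

theorem continuous_orbitHom : Continuous (orbitHom G) := by
  rw [MStr.continuous_to_aut]
  -- Sorts and cosets are separated so that `U = V` can be substituted. Distinct sorts give the
  -- empty set; equal sorts reduce to the continuous action on the discrete quotient.
  suffices h : ∀ (U V : OpenSubgroup G) (a : G ⧸ U.toSubgroup) (b : G ⧸ V.toSubgroup),
      IsOpen {g : G | (orbitHom G g).1 (orbitStr.mk U a) = orbitStr.mk V b} from
    fun x y => h x.1 y.1 x.2 y.2
  intro U V a b
  by_cases hUV : U = V
  · subst hUV
    have : {g : G | (orbitHom G g).1 (orbitStr.mk U a) = orbitStr.mk U b} =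
        (fun g : G => g • a) ⁻¹' {b} := by
      ext g
      exact (orbitStr.mk_injective U).eq_iff (a := g • a)
    rw [this]
    exact (isOpen_discrete {b}).preimage
      (continuous_id.smul continuous_const)
  · convert isOpen_empty
    exact Set.eq_empty_of_forall_notMem fun g hg =>
      hUV (congrArg (Sigma.fst : (orbitStr G).Univ → OpenSubgroup G) hg)

theorem orbitHom_injective [CompactSpace G] [TotallyDisconnectedSpace G] :
    Function.Injective (orbitHom G) := by
  refine (injective_iff_map_eq_one _).2 fun g hg => by_contra fun hne => ?_
  -- An open normal subgroup avoiding `g`: then `g` moves the trivial coset of `H`.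
  obtain ⟨H, hH⟩ := ProfiniteGrp.exist_openNormalSubgroup_sub_open_nhds_of_one
    (isOpen_compl_singleton (x := g)) (fun h => hne h.symm)
  have h := orbitHom_mk G g H.toOpenSubgroup ((1 : G) : G ⧸ H.toSubgroup)
  rw [hg] at h
  have h' : ((1 : G) : G ⧸ H.toSubgroup) = ((g * 1 : G) : G ⧸ H.toSubgroup) :=
    orbitStr.mk_injective H.toOpenSubgroup h
  rw [QuotientGroup.eq] at h'
  exact hH (show g ∈ H.toSubgroup by simpa using h') rfl

/-- A profinite group is the automorphism group of a finitary structure. -/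
noncomputable def orbitEquiv [CompactSpace G] [TotallyDisconnectedSpace G] :
    G ≃ₜ* (orbitStr G).Aut :=
  let e : G ≃* (orbitStr G).Aut := MulEquiv.ofBijective (orbitHom G)
    ⟨orbitHom_injective G,
      MStr.surjective_of_tuples (continuous_orbitHom G) (orbitHom_tuple G)⟩
  { e with
    continuous_toFun := continuous_orbitHom G
    continuous_invFun :=
      (Continuous.homeoOfEquivCompactToT2 (f := e.toEquiv) (continuous_orbitHom G)).symm.continuous }

end OrbitStr

/-! ### The functor -/

/-- The functor of automorphism groups. -/
noncomputable def autFunctor : MStr.{u}ᵒᵖ ⥤ TopGrp.{u} where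
  obj M := ⟨M.unop.Aut⟩
  map f := MStr.homRes f.unop
  map_id M := MStr.homRes_id M.unop
  map_comp f g := MStr.homRes_comp g.unop f.unop

/-- The functor of automorphism groups of finitary structures. -/
noncomputable def profAutFunctor : FinStr.{u}ᵒᵖ ⥤ ProfiniteGrp.{u} where
  obj M :=
    have := M.unop.property.compactSpace
    ProfiniteGrp.of M.unop.obj.Aut
  map {M N} f :=
    have := M.unop.property.compactSpace
    have := N.unop.property.compactSpace
    ProfiniteGrp.ofHom (MStr.homRes f.unop.hom)
  map_id M := ProfiniteGrp.hom_ext (MStr.homRes_id M.unop.obj)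
  map_comp f g := ProfiniteGrp.hom_ext (MStr.homRes_comp g.unop.hom f.unop.hom)

/-- `profAutFunctor` is the restriction of `autFunctor`. -/
noncomputable def profAutFunctorIso :
    profAutFunctor.{u} ⋙ profToTop ≅ finIncl.{u}.op ⋙ autFunctor :=
  NatIso.ofComponents (fun _ => Iso.refl _) fun _ => rfl

instance : profAutFunctor.{u}.Faithful where
  map_injective {_ _} _ _ h := Quiver.Hom.unop_inj <| InducedCategory.hom_ext <|
    MStr.homRes_injective (congrArg ProfiniteGrp.Hom.hom h)

instance : profAutFunctor.{u}.Full where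
  map_surjective {M N} φ := by
    obtain ⟨f, hf⟩ := MStr.homRes_surjective (N := N.unop.obj) (M := M.unop.obj) φ.hom
    exact ⟨Quiver.Hom.op (ObjectProperty.homMk f), ProfiniteGrp.hom_ext hf⟩

instance : profAutFunctor.{u}.EssSurj where
  mem_essImage G :=
    ⟨Opposite.op ⟨orbitStr G, orbitStr_isFinitary G⟩,
      ⟨(ProfiniteGrp.ContinuousMulEquiv.toProfiniteGrpIso
        (X := G) (Y := profAutFunctor.obj (Opposite.op ⟨orbitStr G, orbitStr_isFinitary G⟩))
        (orbitEquiv G)).symm⟩⟩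

instance : profAutFunctor.{u}.IsEquivalence where

end ModelCat

theorem theorem2p6 :
    ∃ (F : ModelCat.MStr.{u}ᵒᵖ ⥤ ModelCat.TopGrp.{u})
      (e : ∀ M : ModelCat.MStr.{u}, F.obj (Opposite.op M) ≃ₜ* M.Aut),
      -- the functor is given by restriction of automorphisms
      (∀ (N M : ModelCat.MStr.{u}) (g : ModelCat.PreMor N M) (σ : F.obj (Opposite.op M))
        (x : N.Univ),
        g.g (e N (ModelCat.TopGrp.hom (F.map g.toHom.op) σ) • x) = e M σ • g.g x) ∧
      -- automorphism groups of finitary structures are profinite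
      (∀ M : ModelCat.MStr.{u}, M.IsFinitary →
        CompactSpace M.Aut ∧ T2Space M.Aut ∧ TotallyDisconnectedSpace M.Aut) ∧
      -- embeddings induce surjections
      (∀ (N M : ModelCat.MStr.{u}) (g : ModelCat.PreMor N M), M.IsFinitary →
        g.IsEmbedding →
        Function.Surjective (ModelCat.TopGrp.hom (F.map g.toHom.op))) ∧
      -- naming parameters induces embeddings
      (∀ (M : ModelCat.MStr.{u}) (S : ModelCat.EqSort M) (A : Set S.Univ),
        Topology.IsEmbedding
          (ModelCat.TopGrp.hom (F.map (ModelCat.PreMor.name M S A).toHom.op))) ∧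
      -- equivalence of categories
      (∃ P : ModelCat.FinStr.{u}ᵒᵖ ⥤ ProfiniteGrp.{u},
        Nonempty (P ⋙ ModelCat.profToTop ≅ ModelCat.finIncl.{u}.op ⋙ F) ∧
        P.IsEquivalence) := by
  refine ⟨ModelCat.autFunctor, fun M => ContinuousMulEquiv.refl M.Aut,
    fun N M g σ x => g.g_res σ x, fun M hM => ⟨hM.compactSpace, inferInstance, inferInstance⟩,
    fun N M g hM hg => hg.res_surjective hM, ModelCat.PreMor.isEmbedding_resHom_name,
    ModelCat.profAutFunctor, ⟨ModelCat.profAutFunctorIso⟩, inferInstance⟩
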